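/- For finite sets $Q, R \subset \mathbb{R}$ and real $t > 0$ put $$\mathrm{Sym}_t^+(Q,R) = \{x \in \mathbb{R} : |Q \cap (x - R)| \ge t\},$$ and for a nonempty finite set $A \subset \mathbb{R}$ put $$d_+(A) = \min \frac{|Q|^2 |R|^2}{|A|\, t^3},$$ where the minimum is taken over all real $t > 0$ and all nonempty finite sets $Q, R \subset \mathbb{R} \setminus \{0\}$ such that $A \subseteq \mathrm{Sym}_t^+(Q,R)$ and $\max\{|Q|,|R|\} \ge |A|$. (For $A = \emptyset$ put $d_+(A) = 0$.) Write $AB^{-1} = \{a/b : a \in A,\ b \in B,\ b \ne 0\}$. Then there is an absolute constant $C > 0$ such that for all finite sets $A, B \subset \mathbb{R}$ and every real number $\tau \ge 1$, $$\bigl|\{s \in AB^{-1} : |A \cap sB| \ge \tau\}\bigr| \le C\, \frac{d_+(A)\,|A|\,|B|^2}{\tau^3}.$$ -/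

import Mathlib

/-- The additive symmetry set `Sym_t^+(Q, R) = {x : |Q ∩ (x - R)| ≥ t}`. -/
def symPlus (t : ℝ) (Q R : Finset ℝ) : Set ℝ :=
  {x : ℝ | t ≤ ((Q ∩ R.image (fun r => x - r)).card : ℝ)}

/-- The values `|Q|² |R|² / (|A| t³)`, over all real `t > 0` and all nonempty finite sets
`Q, R ⊆ ℝ \ {0}` with `A ⊆ Sym_t^+(Q, R)` and `max {|Q|, |R|} ≥ |A|`. -/
def dPlusValues (A : Finset ℝ) : Set ℝ :=
  {v : ℝ | ∃ (t : ℝ) (Q R : Finset ℝ), 0 < t ∧ Q.Nonempty ∧ R.Nonempty ∧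
    (0 : ℝ) ∉ Q ∧ (0 : ℝ) ∉ R ∧ (A : Set ℝ) ⊆ symPlus t Q R ∧ A.card ≤ max Q.card R.card ∧
    v = (Q.card : ℝ) ^ 2 * (R.card : ℝ) ^ 2 / ((A.card : ℝ) * t ^ 3)}

/-- The quantity `d_+(A)`, the least element of `dPlusValues A`
(for nonempty `A` it is attained, see `dPlus_isLeast`). -/
noncomputable def dPlus (A : Finset ℝ) : ℝ := sInf (dPlusValues A)

/-- The quotient set `A B⁻¹ = {a / b : a ∈ A, b ∈ B, b ≠ 0}`. -/
noncomputable def quotSet (A B : Finset ℝ) : Finset ℝ :=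
  (A ×ˢ B.filter (fun b => b ≠ 0)).image (fun p => p.1 / p.2)

/-- The set `{s ∈ A B⁻¹ : |A ∩ s B| ≥ τ}`. -/
noncomputable def richQuotients (A B : Finset ℝ) (τ : ℝ) : Finset ℝ :=
  (quotSet A B).filter (fun s => τ ≤ ((A ∩ B.image (fun b => s * b)).card : ℝ))

theorem dPlusValues_nonempty (A : Finset ℝ) (hA : A.Nonempty) : (dPlusValues A).Nonempty := by
  obtain ⟨x, hx⟩ := Infinite.exists_notMem_finset (insert 0 (A.image (fun a => -a)))
  have hx0 : x ≠ 0 := fun h => hx (by simp [h])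
  have hxA : ∀ a ∈ A, a + x ≠ 0 := fun a ha h =>
    hx (Finset.mem_insert_of_mem (Finset.mem_image.2 ⟨a, ha, by linarith⟩))
  have hc : (A.image (fun a => a + x)).card = A.card :=
    Finset.card_image_of_injective _ (add_left_injective x)
  refine ⟨_, 1, A.image (fun a => a + x), {-x}, one_pos, hA.image _, by simp, ?_, by simpa using hx0,
    ?_, by rw [hc]; exact le_max_left _ _, rfl⟩
  · intro h
    obtain ⟨a, ha, h0⟩ := Finset.mem_image.1 h
    exact hxA a ha h0
  · intro a ha
    have : 0 < (A.image (fun a => a + x) ∩ ({-x} : Finset ℝ).image (fun r => a - r)).card := by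
      refine Finset.card_pos.2 ⟨a + x, Finset.mem_inter.2 ⟨Finset.mem_image.2 ⟨a, ha, rfl⟩, ?_⟩⟩
      simp
    exact (Nat.one_le_cast (α := ℝ)).2 this

/-- For nonempty `A` the minimum that defines `d_+(A)` is attained. -/
theorem dPlus_isLeast (A : Finset ℝ) (hA : A.Nonempty) :
    IsLeast (dPlusValues A) (dPlus A) := by
  classical
  have hA0 : (0 : ℝ) < A.card := by exact_mod_cast hA.card_pos
  -- every value is dominated by a value with an integral `t ≤ |Q|, |R|`
  have key : ∀ v ∈ dPlusValues A, ∃ n q r : ℕ, n ≤ q ∧ n ≤ r ∧ 0 < n ∧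
      (q : ℝ) ^ 2 * (r : ℝ) ^ 2 / ((A.card : ℝ) * (n : ℝ) ^ 3) ∈ dPlusValues A ∧
      (q : ℝ) ^ 2 * (r : ℝ) ^ 2 / ((A.card : ℝ) * (n : ℝ) ^ 3) ≤ v := by
    rintro v ⟨t, Q, R, ht, hQ, hR, hQ0, hR0, hS, hm, rfl⟩
    have hS' : ∀ a ∈ A, ⌈t⌉₊ ≤ (Q ∩ R.image (fun r => a - r)).card :=
      fun a ha => Nat.ceil_le.2 (hS ha)
    obtain ⟨a, ha⟩ := hA
    have hpos : 0 < ⌈t⌉₊ := Nat.ceil_pos.2 ht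
    refine ⟨⌈t⌉₊, Q.card, R.card, (hS' a ha).trans (Finset.card_le_card Finset.inter_subset_left),
      (hS' a ha).trans ((Finset.card_le_card Finset.inter_subset_right).trans
        Finset.card_image_le), hpos,
      ⟨⌈t⌉₊, Q, R, by exact_mod_cast hpos, hQ, hR, hQ0, hR0, ?_, hm, rfl⟩, ?_⟩
    · intro b hb
      exact (Nat.cast_le (α := ℝ)).2 (hS' b hb)
    · have := Nat.le_ceil t
      gcongr
  obtain ⟨v₀, hv₀⟩ := dPlusValues_nonempty A hA
  -- the integral values up to `v₀` form a finite set
  set N : ℕ := ⌈v₀ * A.card⌉₊ with hN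
  set F : Set ℝ := dPlusValues A ∩
    (((Finset.range (N + 1) ×ˢ Finset.range (N + 1) ×ˢ Finset.range (N + 1)).image
      (fun p : ℕ × ℕ × ℕ => (p.2.1 : ℝ) ^ 2 * (p.2.2 : ℝ) ^ 2 / ((A.card : ℝ) * (p.1 : ℝ) ^ 3)) :
        Finset ℝ) : Set ℝ) with hF
  have hFfin : F.Finite := (Finset.finite_toSet _).inter_of_right _
  have key2 : ∀ v ∈ dPlusValues A, v ≤ v₀ → ∃ w ∈ F, w ≤ v := by
    intro v hv hvv
    obtain ⟨n, q, r, hnq, hnr, hn, hw, hwv⟩ := key v hv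
    have hb : (q : ℝ) ^ 2 * (r : ℝ) ^ 2 ≤ v₀ * A.card * (n : ℝ) ^ 3 := by
      have hn' : (0 : ℝ) < n := by exact_mod_cast hn
      have := (div_le_iff₀ (by positivity)).1 (hwv.trans hvv)
      linarith
    have hb' : q ^ 2 * r ^ 2 ≤ N * n ^ 3 := by
      have : (q : ℝ) ^ 2 * (r : ℝ) ^ 2 ≤ (N : ℝ) * (n : ℝ) ^ 3 :=
        hb.trans (mul_le_mul_of_nonneg_right (Nat.le_ceil _) (by positivity))
      exact_mod_cast this
    have hq : q ≤ N := by
      have h1 : q * n ^ 3 ≤ N * n ^ 3 := by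
        refine le_trans ?_ hb'
        calc q * n ^ 3 = q * n * n ^ 2 := by ring
          _ ≤ q * q * r ^ 2 := by gcongr
          _ = q ^ 2 * r ^ 2 := by ring
      exact Nat.le_of_mul_le_mul_right h1 (by positivity)
    have hr : r ≤ N := by
      have h1 : r * n ^ 3 ≤ N * n ^ 3 := by
        refine le_trans ?_ hb'
        calc r * n ^ 3 = n ^ 2 * (r * n) := by ring
          _ ≤ q ^ 2 * (r * r) := by gcongr
          _ = q ^ 2 * r ^ 2 := by ring
      exact Nat.le_of_mul_le_mul_right h1 (by positivity)
    refine ⟨_, ⟨hw, ?_⟩, hwv⟩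
    refine Finset.mem_coe.2 (Finset.mem_image.2 ⟨(n, q, r), ?_, rfl⟩)
    simp only [Finset.mem_product, Finset.mem_range]
    omega
  obtain ⟨w₀, hw₀, hwv₀⟩ := key2 v₀ hv₀ le_rfl
  obtain ⟨m, hm, hmin⟩ := Set.exists_min_image F id hFfin ⟨w₀, hw₀⟩
  have hleast : IsLeast (dPlusValues A) m := by
    refine ⟨hm.1, fun v hv => ?_⟩
    rcases le_total v v₀ with h | h
    · obtain ⟨w, hw, hwv⟩ := key2 v hv h
      exact (hmin w hw).trans hwv
    · exact ((hmin w₀ hw₀).trans hwv₀).trans h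
  rw [dPlus, hleast.csInf_eq]
  exact hleast

/-!
The incidence bound `|I| ≪ (|X| |Y| |L|) ^ (2 / 3) + |L|` between a grid `X × Y` and a family `L` of
strictly monotone pseudolines has an elementary proof. Cut the grid into cells of about `|X| / λ` by
`|Y| / λ` points. A monotone curve meets `O(λ)` cells, so all but `O(λ |L|)` incidences share
their cell with another incidence of the same curve. Since two points determine a curve, there are
at most as many such pairs as pairs of grid points sharing a cell, that is `O(|X|² |Y|² / λ²)`.
Balance at `λ³ |L| = |X|² |Y|²`.

Suppose `A ⊆ Sym_t^+(Q, R)` and that `s` is a `τ`-rich quotient. Up to the factor lost by discarding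
`b = 0`, there are `τ` elements `b ∈ B` with `s b ∈ A`, and each such `s b` equals `q + r` in `t`
ways. So `s` is the abscissa of `≫ t τ` incidences of the lines `y = b x - q` with heights in `R`,
and the incidence bound limits the number of such `s`. The linear term of the bound is absorbed
because `|A| ≤ max {|Q|, |R|}`.
-/

section Colouring

open Finset

variable {α κ : Type*} [DecidableEq κ]

theorem card_le_card_image_add_card_offDiag_filter (T : Finset α) (c : α → κ) :
    #T ≤ #(T.image c) + #{p ∈ T.offDiag | c p.1 = c p.2} := by
  have hfiber (k : κ) :
      #{p ∈ {p ∈ T.offDiag | c p.1 = c p.2} | c p.1 = k} = #{x ∈ T | c x = k}.offDiag := by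
    congr 1
    ext p
    simp only [mem_filter, mem_offDiag]
    grind
  have hpairs : #{p ∈ T.offDiag | c p.1 = c p.2} =
      ∑ k ∈ T.image c, #{x ∈ T | c x = k}.offDiag := by
    rw [card_eq_sum_card_fiberwise (f := fun p : α × α => c p.1) (t := T.image c)]
    · exact sum_congr rfl fun k _ => hfiber k
    · intro p hp
      exact mem_image_of_mem c (mem_offDiag.1 (mem_filter.1 hp).1).1
  have hsmall (n : ℕ) : n ≤ 1 + (n * n - n) := by
    rcases Nat.lt_or_ge n 2 with h | h
    · lia
    · have := Nat.mul_le_mul_right n h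
      lia
  calc #T = ∑ k ∈ T.image c, #{x ∈ T | c x = k} := card_eq_sum_card_image c T
    _ ≤ ∑ k ∈ T.image c, (1 + #{x ∈ T | c x = k}.offDiag) :=
      sum_le_sum fun k _ => by rw [offDiag_card]; exact hsmall _
    _ = #(T.image c) + #{p ∈ T.offDiag | c p.1 = c p.2} := by
      rw [sum_add_distrib, ← card_eq_sum_ones, hpairs]

theorem card_filter_eq_le_card_mul (X : Finset α) (c : α → κ) {u : ℕ}
    (hc : ∀ k, #{x ∈ X | c x = k} ≤ u) : #{p ∈ X ×ˢ X | c p.1 = c p.2} ≤ #X * u := by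
  rw [card_filter, sum_product, ← smul_eq_mul]
  refine sum_le_card_nsmul X _ u fun x _ => ?_
  rw [← card_filter]
  simpa only [eq_comm] using hc (c x)

end Colouring

section Cells

open Finset

variable {α : Type*} [LinearOrder α]

theorem monotone_card_filter_lt (X : Finset α) : Monotone fun x => #{z ∈ X | z < x} :=
  fun _ _ hxy => card_le_card (monotone_filter_right _ fun _ _ hz => hz.trans_le hxy)

theorem strictMonoOn_card_filter_lt (X : Finset α) :
    StrictMonoOn (fun x => #{z ∈ X | z < x}) X := by
  intro x hx y _ hxy
  refine card_lt_card ((ssubset_iff_of_subset ?_).2 ⟨x, ?_, ?_⟩)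
  · exact monotone_filter_right _ fun _ _ hz => hz.trans hxy
  · exact mem_filter.2 ⟨hx, hxy⟩
  · simp

theorem exists_monotone_card_fiber_le (X : Finset α) {u : ℕ} (hu : 0 < u) :
    ∃ f : α → Fin (#X / u + 1), Monotone f ∧ ∀ k, #{x ∈ X | f x = k} ≤ u := by
  refine ⟨fun x => ⟨#{z ∈ X | z < x} / u,
    Nat.lt_succ_of_le (Nat.div_le_div_right (card_filter_le _ _))⟩, ?_, fun k => ?_⟩
  · exact fun x y hxy => Nat.div_le_div_right (monotone_card_filter_lt X hxy)
  · calc _ ≤ #(Ico (k * u : ℕ) (k * u + u)) := by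
          refine card_le_card_of_injOn (fun x => #{z ∈ X | z < x}) (fun x hx => ?_) ?_
          · have hk : #{z ∈ X | z < x} / u = k := congrArg Fin.val (mem_filter.1 hx).2
            rw [← hk, coe_Ico, Set.mem_Ico]
            exact ⟨Nat.div_mul_le_self _ u, Nat.lt_div_mul_add hu⟩
          · exact (strictMonoOn_card_filter_lt X).injOn.mono fun x hx => (mem_filter.1 hx).1
      _ = u := by simp

theorem card_image_prodMk_le_of_monotone {a b : ℕ} (T : Finset α) {f : α → Fin (a + 1)}
    {h : α → Fin (b + 1)} (hf : Monotone f) (hh : Monotone h) :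
    #(T.image fun x => (f x, h x)) ≤ a + b + 1 := by
  calc _ ≤ #(range (a + b + 1)) := by
        refine card_le_card_of_injOn (fun p => (p.1 + p.2 : ℕ)) (fun p _ => ?_) ?_
        · simp only [coe_range, Set.mem_Iio]
          lia
        · rw [coe_image]
          rintro _ ⟨x, _, rfl⟩ _ ⟨y, _, rfl⟩ hxy
          simp only [Prod.mk.injEq, Fin.ext_iff] at hxy ⊢
          rcases le_total x y with hle | hle
          all_goals
            have hfle := Fin.le_def.1 (hf hle)
            have hhle := Fin.le_def.1 (hh hle)
            lia
    _ = a + b + 1 := card_range _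

theorem card_image_prodMk_le {a b : ℕ} (T : Finset α) {f : α → Fin (a + 1)} {h : α → Fin (b + 1)}
    (hf : Monotone f) (hh : Monotone h ∨ Antitone h) :
    #(T.image fun x => (f x, h x)) ≤ a + b + 1 := by
  rcases hh with hh | hh
  · exact card_image_prodMk_le_of_monotone T hf hh
  · have hrev : Monotone fun x => (h x).rev := fun x y hxy => Fin.rev_le_rev.2 (hh hxy)
    have hinj : Function.Injective (Prod.map id Fin.rev : Fin (a + 1) × Fin (b + 1) → _) :=
      Function.injective_id.prodMap Fin.rev_injective
    rw [← card_image_of_injective _ hinj, image_image]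
    exact card_image_prodMk_le_of_monotone T hf hrev

end Cells

section Incidences

open Finset

variable {ι α β : Type*}

/-- The incidences between the grid `X × Y` and the graphs of the functions `φ i`, `i ∈ L`.
The incidence of the point `(x, φ i x)` with the graph of `φ i` is encoded as `(i, x)`. -/
def gridIncidences [DecidableEq β] (φ : ι → α → β) (L : Finset ι) (X : Finset α) (Y : Finset β) :
    Finset (ι × α) :=
  {p ∈ L ×ˢ X | φ p.1 p.2 ∈ Y}

/-- The graphs of the functions `φ i`, `i ∈ L`, form a family of strictly monotone pseudolines:
two points with different abscissae lie on at most one of them. This is what the incidence bound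
needs to know about lines of nonzero slope. -/
structure IsPseudolineFamily [Preorder α] [Preorder β] (φ : ι → α → β) (L : Set ι) : Prop where
  strictMono_or_strictAnti : ∀ i ∈ L, StrictMono (φ i) ∨ StrictAnti (φ i)
  injOn_eval_pair : ∀ x x', x ≠ x' → Set.InjOn (fun i => (φ i x, φ i x')) L

theorem isPseudolineFamily_lines {K : Type*} [Field K] [LinearOrder K] [IsStrictOrderedRing K]
    {L : Set (K × K)} (hL : ∀ ℓ ∈ L, ℓ.1 ≠ 0) :
    IsPseudolineFamily (fun (ℓ : K × K) x => ℓ.1 * x - ℓ.2) L where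
  strictMono_or_strictAnti ℓ hℓ := by
    rcases (hL ℓ hℓ).lt_or_gt with h | h
    · exact .inr fun x y hxy => sub_lt_sub_right (mul_lt_mul_of_neg_left hxy h) _
    · exact .inl fun x y hxy => sub_lt_sub_right (mul_lt_mul_of_pos_left hxy h) _
  injOn_eval_pair x x' hne := by
    rintro ⟨m, c⟩ _ ⟨m', c'⟩ _ heq
    obtain ⟨hx, hx'⟩ := Prod.mk.inj heq
    dsimp only at hx hx'
    have hm : m = m' := mul_right_cancel₀ (sub_ne_zero.2 hne) (by linear_combination hx - hx')
    subst hm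
    exact Prod.ext rfl (by linear_combination -hx)

theorem card_gridIncidences_eq_sum_curves [DecidableEq β] (φ : ι → α → β) (L : Finset ι)
    (X : Finset α) (Y : Finset β) :
    #(gridIncidences φ L X Y) = ∑ i ∈ L, #{x ∈ X | φ i x ∈ Y} := by
  simp only [gridIncidences, card_filter, sum_product]

theorem card_gridIncidences_eq_sum_abscissae [DecidableEq β] (φ : ι → α → β) (L : Finset ι)
    (X : Finset α) (Y : Finset β) :
    #(gridIncidences φ L X Y) = ∑ x ∈ X, #{i ∈ L | φ i x ∈ Y} := by
  simp only [gridIncidences, card_filter, sum_product_right]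

theorem card_gridIncidences_le_card_mul_card_left [DecidableEq β] (φ : ι → α → β) (L : Finset ι)
    (X : Finset α) (Y : Finset β) : #(gridIncidences φ L X Y) ≤ #L * #X :=
  (card_filter_le _ _).trans_eq (card_product L X)

theorem sum_card_offDiag_filter_le_of_injOn {κ κ' : Type*} [DecidableEq β] [DecidableEq κ]
    [DecidableEq κ'] {φ : ι → α → β} {L : Finset ι}
    (hφ : ∀ x x', x ≠ x' → Set.InjOn (fun i => (φ i x, φ i x')) L) (X : Finset α) (Y : Finset β)
    (f : α → κ) (g : β → κ') :
    ∑ i ∈ L, #{p ∈ {x ∈ X | φ i x ∈ Y}.offDiag | (f p.1, g (φ i p.1)) = (f p.2, g (φ i p.2))} ≤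
      #{p ∈ X ×ˢ X | f p.1 = f p.2} * #{p ∈ Y ×ˢ Y | g p.1 = g p.2} := by
  rw [← card_sigma, ← card_product]
  refine card_le_card_of_injOn (fun s => (s.2, (φ s.1 s.2.1, φ s.1 s.2.2))) ?_ ?_
  · rintro ⟨i, x, x'⟩ hs
    simp only [coe_sigma, Set.mem_sigma_iff, mem_coe, mem_filter, mem_offDiag, mem_product,
      Prod.mk.injEq] at hs ⊢
    tauto
  · rintro ⟨i, x, x'⟩ hs ⟨j, z, z'⟩ ht heq
    simp only [coe_sigma, Set.mem_sigma_iff, mem_coe, mem_filter, mem_offDiag] at hs ht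
    obtain ⟨hxz, hval⟩ := Prod.mk.inj heq
    obtain ⟨rfl, rfl⟩ := Prod.mk.inj hxz
    obtain rfl : i = j := hφ x x' hs.2.1.2.2 hs.1 ht.1 hval
    rfl

namespace IsPseudolineFamily

variable [LinearOrder α] [LinearOrder β] {φ : ι → α → β} {L : Finset ι}

theorem card_gridIncidences_le_card_mul_card_right (hφ : IsPseudolineFamily φ (L : Set ι))
    (X : Finset α) (Y : Finset β) : #(gridIncidences φ L X Y) ≤ #L * #Y := by
  rw [card_gridIncidences_eq_sum_curves, ← smul_eq_mul]
  refine sum_le_card_nsmul L _ _ fun i hi => ?_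
  have hinj : Function.Injective (φ i) :=
    (hφ.strictMono_or_strictAnti i hi).elim StrictMono.injective StrictAnti.injective
  exact card_le_card_of_injOn (φ i) (fun x hx => (mem_filter.1 hx).2) hinj.injOn

theorem card_gridIncidences_le_of_cells (hφ : IsPseudolineFamily φ (L : Set ι)) (X : Finset α)
    (Y : Finset β) {u v : ℕ} (hu : 0 < u) (hv : 0 < v) :
    #(gridIncidences φ L X Y) ≤ #L * (#X / u + #Y / v + 1) + #X * u * (#Y * v) := by
  obtain ⟨f, hf, hfu⟩ := exists_monotone_card_fiber_le X hu
  obtain ⟨g, hg, hgv⟩ := exists_monotone_card_fiber_le Y hv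
  have hcurve : ∀ i ∈ L, #{x ∈ X | φ i x ∈ Y} ≤ (#X / u + #Y / v + 1) +
      #{p ∈ {x ∈ X | φ i x ∈ Y}.offDiag | (f p.1, g (φ i p.1)) = (f p.2, g (φ i p.2))} := by
    intro i hi
    have hgφ : Monotone (g ∘ φ i) ∨ Antitone (g ∘ φ i) :=
      (hφ.strictMono_or_strictAnti i hi).imp (hg.comp ·.monotone) (hg.comp_antitone ·.antitone)
    exact (card_le_card_image_add_card_offDiag_filter _ fun x => (f x, g (φ i x))).trans
      (Nat.add_le_add_right (card_image_prodMk_le _ hf hgφ) _)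
  calc #(gridIncidences φ L X Y) = ∑ i ∈ L, #{x ∈ X | φ i x ∈ Y} :=
        card_gridIncidences_eq_sum_curves φ L X Y
    _ ≤ #L * (#X / u + #Y / v + 1) + ∑ i ∈ L, #{p ∈ {x ∈ X | φ i x ∈ Y}.offDiag |
          (f p.1, g (φ i p.1)) = (f p.2, g (φ i p.2))} := by
      rw [← smul_eq_mul, ← sum_const, ← sum_add_distrib]
      exact sum_le_sum hcurve
    _ ≤ #L * (#X / u + #Y / v + 1) + #X * u * (#Y * v) := by
      gcongr
      exact (sum_card_offDiag_filter_le_of_injOn hφ.injOn_eval_pair X Y f g).trans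
        (Nat.mul_le_mul (card_filter_eq_le_card_mul X f hfu) (card_filter_eq_le_card_mul Y g hgv))

end IsPseudolineFamily

end Incidences

section SzemerediTrotter

open Finset

theorem rpow_two_div_three_pow_three {z : ℝ} (hz : 0 ≤ z) : (z ^ (2 / 3 : ℝ)) ^ 3 = z ^ 2 := by
  rw [← Real.rpow_mul_natCast hz, ← Real.rpow_natCast]
  norm_num

theorem exists_pos_nat_div_le {x r : ℝ} (hr : 0 < r) (hrx : r ≤ x) :
    ∃ u : ℕ, 0 < u ∧ x / u ≤ r ∧ (u : ℝ) ≤ 2 * (x / r) := by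
  have hone : 1 ≤ x / r := (one_le_div hr).2 hrx
  have hpos : 0 < ⌈x / r⌉₊ := Nat.ceil_pos.2 (by linarith)
  refine ⟨⌈x / r⌉₊, hpos, ?_, Nat.ceil_le_two_mul (by linarith)⟩
  rw [div_le_comm₀ (by exact_mod_cast hpos) hr]
  exact Nat.le_ceil _

theorem le_six_mul_rpow_add_of_forall_cells {I x y l : ℝ} (hx : 0 < x) (hy : 0 < y) (hl : 0 < l)
    (hIx : I ≤ l * x) (hIy : I ≤ l * y)
    (hcell : ∀ u v : ℕ, 0 < u → 0 < v → I ≤ l * (x / u + y / v + 1) + x * u * (y * v)) :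
    I ≤ 6 * (x * y * l) ^ (2 / 3 : ℝ) + l := by
  set M : ℝ := (x * y * l) ^ (2 / 3 : ℝ)
  have hMpos : 0 < M := by positivity
  obtain ⟨r, hrM⟩ : ∃ r, l * r = M := ⟨M / l, mul_div_cancel₀ M hl.ne'⟩
  have hr : 0 < r := pos_of_mul_pos_right (hrM ▸ hMpos) hl.le
  have hbalance : x ^ 2 * y ^ 2 = l * r ^ 3 := by
    have hcube : M ^ 3 = (x * y * l) ^ 2 := rpow_two_div_three_pow_three (by positivity)
    refine mul_left_cancel₀ (pow_pos hl 2).ne' ?_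
    rw [← hrM] at hcube
    linear_combination -hcube
  rcases le_total x r with hxr | hrx
  · have : l * x ≤ M := hrM ▸ by gcongr
    linarith
  rcases le_total y r with hyr | hry
  · have : l * y ≤ M := hrM ▸ by gcongr
    linarith
  obtain ⟨u, hu, hxu, hur⟩ := exists_pos_nat_div_le hr hrx
  obtain ⟨v, hv, hyv, hvr⟩ := exists_pos_nat_div_le hr hry
  calc I ≤ l * (x / u + y / v + 1) + x * u * (y * v) := hcell u v hu hv
    _ ≤ l * (r + r + 1) + x * (2 * (x / r)) * (y * (2 * (y / r))) := by gcongr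
    _ = 2 * (l * r) + l + 4 * ((x ^ 2 * y ^ 2) / r ^ 2) := by field_simp; ring
    _ = 2 * (l * r) + l + 4 * (l * r) := by rw [hbalance]; field_simp
    _ = 6 * M + l := by rw [hrM]; ring

namespace IsPseudolineFamily

variable {ι α β : Type*} [LinearOrder α] [LinearOrder β] {φ : ι → α → β} {L : Finset ι}

theorem szemeredi_trotter_grid (hφ : IsPseudolineFamily φ (L : Set ι)) (X : Finset α)
    (Y : Finset β) :
    (#(gridIncidences φ L X Y) : ℝ) ≤ 6 * ((#X : ℝ) * #Y * #L) ^ (2 / 3 : ℝ) + #L := by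
  have hIX : (#(gridIncidences φ L X Y) : ℝ) ≤ #L * #X := by
    exact_mod_cast card_gridIncidences_le_card_mul_card_left φ L X Y
  have hIY : (#(gridIncidences φ L X Y) : ℝ) ≤ #L * #Y := by
    exact_mod_cast hφ.card_gridIncidences_le_card_mul_card_right X Y
  by_cases hzero : (#L : ℝ) * #X = 0 ∨ (#L : ℝ) * #Y = 0
  · have hI : (#(gridIncidences φ L X Y) : ℝ) ≤ 0 := hzero.elim hIX.trans_eq hIY.trans_eq
    exact hI.trans (by positivity)
  simp only [not_or, mul_ne_zero_iff, Nat.cast_ne_zero] at hzero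
  obtain ⟨⟨hL, hX⟩, -, hY⟩ := hzero
  refine le_six_mul_rpow_add_of_forall_cells (by positivity) (by positivity) (by positivity)
    hIX hIY fun u v hu hv => ?_
  calc (#(gridIncidences φ L X Y) : ℝ)
      ≤ ((#L * (#X / u + #Y / v + 1) + #X * u * (#Y * v) : ℕ) : ℝ) := by
        exact_mod_cast hφ.card_gridIncidences_le_of_cells X Y hu hv
    _ ≤ #L * ((#X : ℝ) / u + #Y / v + 1) + #X * u * (#Y * v) := by
      push_cast
      gcongr <;> exact Nat.cast_div_le

theorem card_mul_cube_le_of_forall_le_card (hφ : IsPseudolineFamily φ (L : Set ι)) {X : Finset α}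
    {Y : Finset β} {k : ℝ} (hk : 0 ≤ k) (hrich : ∀ x ∈ X, k ≤ #{i ∈ L | φ i x ∈ Y})
    (hkL : k ^ 2 ≤ (#Y : ℝ) ^ 2 * #L) :
    #X * k ^ 3 ≤ 343 * ((#Y : ℝ) * #L) ^ 2 := by
  rcases X.eq_empty_or_nonempty with rfl | hX
  · simp only [card_empty, Nat.cast_zero, zero_mul]
    positivity
  have hXpos : (0 : ℝ) < #X := by exact_mod_cast hX.card_pos
  set M : ℝ := ((#X : ℝ) * #Y * #L) ^ (2 / 3 : ℝ)
  have hlower : #X * k ≤ #(gridIncidences φ L X Y) := by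
    rw [card_gridIncidences_eq_sum_abscissae, ← nsmul_eq_mul]
    push_cast
    exact card_nsmul_le_sum X _ k hrich
  have hupper : (#(gridIncidences φ L X Y) : ℝ) ≤ 6 * M + #L := hφ.szemeredi_trotter_grid X Y
  have hsum : #X * k ≤ 6 * M + #L := hlower.trans hupper
  rcases le_total (#L : ℝ) M with hLM | hML
  · have hXk : #X * k ≤ 7 * M := by linarith
    have hcube : M ^ 3 = ((#X : ℝ) * #Y * #L) ^ 2 := rpow_two_div_three_pow_three (by positivity)
    refine le_of_mul_le_mul_left ?_ (pow_pos hXpos 2)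
    calc (#X : ℝ) ^ 2 * (#X * k ^ 3) = (#X * k) ^ 3 := by ring
      _ ≤ (7 * M) ^ 3 := by gcongr
      _ = (#X : ℝ) ^ 2 * (343 * ((#Y : ℝ) * #L) ^ 2) := by rw [mul_pow, hcube]; ring
  · have hXk : #X * k ≤ 7 * #L := by linarith
    calc #X * k ^ 3 = #X * k * k ^ 2 := by ring
      _ ≤ 7 * #L * ((#Y : ℝ) ^ 2 * #L) := by gcongr
      _ = 7 * ((#Y : ℝ) * #L) ^ 2 := by ring
      _ ≤ 343 * ((#Y : ℝ) * #L) ^ 2 := by gcongr; norm_num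

end IsPseudolineFamily

end SzemerediTrotter

section RichQuotients

open Finset

variable {A B Q R : Finset ℝ} {s t τ x : ℝ}

theorem mem_symPlus_iff : x ∈ symPlus t Q R ↔ t ≤ #{q ∈ Q | x - q ∈ R} := by
  have : Q ∩ R.image (fun r => x - r) = {q ∈ Q | x - q ∈ R} := by
    ext q
    simp only [mem_inter, mem_image, mem_filter, sub_eq_iff_eq_add]
    grind
  rw [symPlus, Set.mem_ofPred_eq, this]

theorem le_card_left_of_mem_symPlus (hx : x ∈ symPlus t Q R) : t ≤ #Q :=
  hx.trans (Nat.cast_le.2 (card_le_card inter_subset_left))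

theorem le_card_right_of_mem_symPlus (hx : x ∈ symPlus t Q R) : t ≤ #R :=
  hx.trans (Nat.cast_le.2 ((card_le_card inter_subset_right).trans card_image_le))

theorem le_card_left_of_mem_richQuotients (hs : s ∈ richQuotients A B τ) : τ ≤ #A :=
  (mem_filter.1 hs).2.trans (Nat.cast_le.2 (card_le_card inter_subset_left))

theorem exists_mul_mem_of_mem_quotSet (hs : s ∈ quotSet A B) : ∃ b ∈ B.erase 0, s * b ∈ A := by
  obtain ⟨⟨a, b⟩, hab, rfl⟩ := mem_image.1 hs
  simp only [mem_product, mem_filter] at hab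
  obtain ⟨ha, hb, hb0⟩ := hab
  exact ⟨b, mem_erase.2 ⟨hb0, hb⟩, by rwa [div_mul_cancel₀ a hb0]⟩

theorem card_inter_image_mul_le (A B : Finset ℝ) (s : ℝ) :
    #(A ∩ B.image fun b => s * b) ≤ #{b ∈ B.erase 0 | s * b ∈ A} + 1 := by
  have hsub : (A ∩ B.image fun b => s * b) ⊆
      insert 0 ({b ∈ B.erase 0 | s * b ∈ A}.image fun b => s * b) := by
    intro x hx
    obtain ⟨hxA, hxB⟩ := mem_inter.1 hx
    obtain ⟨b, hb, rfl⟩ := mem_image.1 hxB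
    by_cases hb0 : b = 0
    · simp [hb0]
    · exact mem_insert_of_mem
        (mem_image_of_mem _ (mem_filter.2 ⟨mem_erase.2 ⟨hb0, hb⟩, hxA⟩))
  exact (card_le_card hsub).trans ((card_insert_le _ _).trans
    (Nat.add_le_add_right card_image_le 1))

theorem half_le_card_filter_of_mem_richQuotients (hs : s ∈ richQuotients A B τ) :
    τ / 2 ≤ #{b ∈ B.erase 0 | s * b ∈ A} := by
  obtain ⟨hquot, hτ⟩ := mem_filter.1 hs
  have hone : (1 : ℝ) ≤ #{b ∈ B.erase 0 | s * b ∈ A} := by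
    exact_mod_cast card_pos.2 (filter_nonempty_iff.2 (exists_mul_mem_of_mem_quotSet hquot))
  have hinter : (#(A ∩ B.image fun b => s * b) : ℝ) ≤ #{b ∈ B.erase 0 | s * b ∈ A} + 1 := by
    exact_mod_cast card_inter_image_mul_le A B s
  linarith

theorem mul_half_le_card_lines_of_mem_richQuotients (ht : 0 ≤ t)
    (hA : (A : Set ℝ) ⊆ symPlus t Q R) (hs : s ∈ richQuotients A B τ) :
    t * (τ / 2) ≤ #{ℓ ∈ B.erase 0 ×ˢ Q | ℓ.1 * s - ℓ.2 ∈ R} := by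
  calc t * (τ / 2) ≤ t * #{b ∈ B.erase 0 | s * b ∈ A} := by
        gcongr
        exact half_le_card_filter_of_mem_richQuotients hs
    _ ≤ ∑ b ∈ B.erase 0 with s * b ∈ A, (#{q ∈ Q | b * s - q ∈ R} : ℝ) := by
      rw [mul_comm, ← nsmul_eq_mul]
      refine card_nsmul_le_sum _ _ t fun b hb => ?_
      rw [mul_comm b s]
      exact mem_symPlus_iff.1 (hA (mem_filter.1 hb).2)
    _ ≤ ∑ b ∈ B.erase 0, (#{q ∈ Q | b * s - q ∈ R} : ℝ) :=
      sum_le_sum_of_subset_of_nonneg (filter_subset _ _) fun _ _ _ => Nat.cast_nonneg _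
    _ = #{ℓ ∈ B.erase 0 ×ˢ Q | ℓ.1 * s - ℓ.2 ∈ R} := by
      simp only [card_filter, sum_product, Nat.cast_sum]

theorem sq_mul_half_le_of_mem_richQuotients (ht : 0 ≤ t) (hτ : 0 ≤ τ)
    (hA : (A : Set ℝ) ⊆ symPlus t Q R) (hcard : #A ≤ max #Q #R) (hs : s ∈ richQuotients A B τ) :
    (t * (τ / 2)) ^ 2 ≤ (#R : ℝ) ^ 2 * #(B.erase 0 ×ˢ Q) := by
  obtain ⟨b, -, hsb⟩ := exists_mul_mem_of_mem_quotSet (mem_filter.1 hs).1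
  have htQ : t ≤ #Q := le_card_left_of_mem_symPlus (hA hsb)
  have htR : t ≤ #R := le_card_right_of_mem_symPlus (hA hsb)
  have hτB : τ / 2 ≤ #(B.erase 0) :=
    (half_le_card_filter_of_mem_richQuotients hs).trans (Nat.cast_le.2 (card_filter_le _ _))
  have hτA : τ / 2 ≤ #A := by linarith [le_card_left_of_mem_richQuotients hs]
  rw [card_product, Nat.cast_mul]
  rcases le_max_iff.1 hcard with hAQ | hAR
  · have hτQ : τ / 2 ≤ #Q := hτA.trans (Nat.cast_le.2 hAQ)
    calc (t * (τ / 2)) ^ 2 = t ^ 2 * (τ / 2 * (τ / 2)) := by ring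
      _ ≤ (#R : ℝ) ^ 2 * (#(B.erase 0) * #Q) := by gcongr
  · have hτR : τ / 2 ≤ #R := hτA.trans (Nat.cast_le.2 hAR)
    calc (t * (τ / 2)) ^ 2 = t * (τ / 2) * (τ / 2 * t) := by ring
      _ ≤ (#R : ℝ) * #R * (#(B.erase 0) * #Q) := by gcongr
      _ = (#R : ℝ) ^ 2 * (#(B.erase 0) * #Q) := by ring

theorem card_richQuotients_mul_cube_le (ht : 0 ≤ t) (hτ : 0 ≤ τ)
    (hA : (A : Set ℝ) ⊆ symPlus t Q R) (hcard : #A ≤ max #Q #R) :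
    #(richQuotients A B τ) * (t * τ) ^ 3 ≤ 2744 * ((#Q : ℝ) * #R * #B) ^ 2 := by
  rcases (richQuotients A B τ).eq_empty_or_nonempty with hempty | ⟨s, hs⟩
  · rw [hempty, card_empty, Nat.cast_zero, zero_mul]
    positivity
  have hlines : IsPseudolineFamily (fun (ℓ : ℝ × ℝ) x => ℓ.1 * x - ℓ.2)
      (B.erase 0 ×ˢ Q : Finset (ℝ × ℝ)) :=
    isPseudolineFamily_lines fun ℓ hℓ => ne_of_mem_erase (mem_product.1 hℓ).1
  have hL : (#(B.erase 0 ×ˢ Q) : ℝ) ≤ #B * #Q := by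
    rw [card_product, Nat.cast_mul]
    gcongr
    exact erase_subset 0 B
  have hcube := hlines.card_mul_cube_le_of_forall_le_card (by positivity)
    (fun s hs => mul_half_le_card_lines_of_mem_richQuotients ht hA hs)
    (sq_mul_half_le_of_mem_richQuotients ht hτ hA hcard hs)
  calc #(richQuotients A B τ) * (t * τ) ^ 3
      = 8 * (#(richQuotients A B τ) * (t * (τ / 2)) ^ 3) := by ring
    _ ≤ 8 * (343 * ((#R : ℝ) * #(B.erase 0 ×ˢ Q)) ^ 2) := by gcongr
    _ ≤ 8 * (343 * ((#R : ℝ) * (#B * #Q)) ^ 2) := by gcongr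
    _ = 2744 * ((#Q : ℝ) * #R * #B) ^ 2 := by ring

end RichQuotients

theorem lemma16_general (A B : Finset ℝ) {τ : ℝ} (hτ : 0 < τ) :
    ((richQuotients A B τ).card : ℝ) ≤
      2744 * (dPlus A * (A.card : ℝ) * (B.card : ℝ) ^ 2 / τ ^ 3) := by
  rcases A.eq_empty_or_nonempty with rfl | hA
  · simp [richQuotients, quotSet]
  obtain ⟨t, Q, R, ht, -, -, -, -, hsym, hcard, hd⟩ := (dPlus_isLeast A hA).1
  have : (0 : ℝ) < A.card := by exact_mod_cast hA.card_pos
  have hrhs : dPlus A * (A.card : ℝ) * (B.card : ℝ) ^ 2 / τ ^ 3 =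
      ((Q.card : ℝ) * R.card * B.card) ^ 2 / (t * τ) ^ 3 := by
    rw [hd]
    field_simp
  rw [hrhs, mul_div_assoc', le_div_iff₀ (by positivity)]
  exact card_richQuotients_mul_cube_le ht.le hτ.le hsym hcard

theorem lemma16 :
    ∃ C : ℝ, 0 < C ∧ ∀ (A B : Finset ℝ) (τ : ℝ), 1 ≤ τ →
      ((richQuotients A B τ).card : ℝ) ≤
        C * (dPlus A * (A.card : ℝ) * (B.card : ℝ) ^ 2 / τ ^ 3) :=
  ⟨2744, by norm_num, fun A B _ hτ => lemma16_general A B (zero_lt_one.trans_le hτ)⟩
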